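/- Let $G$ be a virtually abelian group with a normal subgroup $Z$ of finite index such that $Z \cong \mathbb{Z}^n$ for some $n \ge 0$. Let $S$ be a finite subset of $G$ that generates $G$ as a monoid, and let $\omega \colon S \to \{1,2,3,\dots\}$ be any weight function. Define the weight of a word $s_1 s_2 \cdots s_l$ over $S$ to be $\omega(s_1) + \cdots + \omega(s_l)$. Let $F$ be a subgroup of $G$ contained in $Z$. Define the weight of a right coset $Fg \in F\backslash G$ to be the minimal weight among all words over $S$ that represent an element of $Fg$, and let $\sigma(k)$ be the (finite) number of right cosets of $F$ in $G$ of weight $k$. Then the weighted growth series of $F\backslash G$ with respect to $S$ and $\omega$, $$\sum_{k=0}^{\infty} \sigma(k) z^k,$$ is rational, i.e. it equals $p(z)/q(z)$ for some polynomials $p, q$ with integer coefficients, $q \neq 0$. -/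

import Mathlib

open Polynomial

namespace CosetGrowth

/-- The element of `G` represented by a word over the set `S`. -/
def eval {G : Type*} [Group G] {S : Set G} (w : List S) : G :=
  (w.map Subtype.val).prod

/-- The weight of a word: the sum of the weights of its letters. -/
def wordWeight {G : Type*} {S : Set G} (ω : S → ℕ) (w : List S) : ℕ :=
  (w.map ω).sum

/-- The set `F \ G` of right cosets `F g`. -/
abbrev RightCosets {G : Type*} [Group G] (F : Subgroup G) : Type _ :=
  Quotient (QuotientGroup.rightRel F)

/-- The right coset `F g`. -/
def rightCoset {G : Type*} [Group G] (F : Subgroup G) (g : G) : RightCosets F :=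
  Quotient.mk (QuotientGroup.rightRel F) g

/-- The weight of a right coset: the minimal weight among all words representing one of its
elements. -/
noncomputable def cosetWeight {G : Type*} [Group G] (F : Subgroup G) {S : Set G} (ω : S → ℕ)
    (c : RightCosets F) : ℕ :=
  sInf {k : ℕ | ∃ w : List S, rightCoset F (eval w) = c ∧ wordWeight ω w = k}

/-- The weighted growth function of `F \ G`: the number of right cosets of weight `k`. -/
noncomputable def cosetGrowth {G : Type*} [Group G] (F : Subgroup G) {S : Set G} (ω : S → ℕ)
    (k : ℕ) : ℕ :=
  Set.ncard {c : RightCosets F | cosetWeight F ω c = k}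

/-- The weighted growth series of `F \ G`, as a formal power series with integer coefficients. -/
noncomputable def cosetGrowthSeries {G : Type*} [Group G] (F : Subgroup G) {S : Set G}
    (ω : S → ℕ) : PowerSeries ℤ :=
  PowerSeries.mk fun k => (cosetGrowth F ω k : ℤ)

/-- A formal power series is rational if it is a quotient `p / q` of two polynomials with
integer coefficients. -/
def IsRational (f : PowerSeries ℤ) : Prop :=
  ∃ p q : ℤ[X], q ≠ 0 ∧ (q : PowerSeries ℤ) * f = (p : PowerSeries ℤ)

/-- The minimum in the definition of `cosetWeight` is attained. -/
theorem exists_word_of_cosetWeight {G : Type*} [Group G] (F : Subgroup G) {S : Set G}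
    (ω : S → ℕ) (hS : Submonoid.closure S = ⊤) (c : RightCosets F) :
    ∃ w : List S, rightCoset F (eval w) = c ∧ wordWeight ω w = cosetWeight F ω c := by
  refine Nat.sInf_mem (s := {k : ℕ | ∃ w : List S, rightCoset F (eval w) = c ∧
    wordWeight ω w = k}) ?_
  obtain ⟨g, rfl⟩ := Quotient.exists_rep c
  obtain ⟨l, hl, hg⟩ := Submonoid.exists_list_of_mem_closure
    (show g ∈ Submonoid.closure S by rw [hS]; trivial)
  refine ⟨_, l.attach.map (fun x => ⟨x.1, hl x.1 x.2⟩), ?_, rfl⟩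
  have : (List.map Subtype.val (l.attach.map (fun x => (⟨x.1, hl x.1 x.2⟩ : S)))) = l := by
    simp [List.map_map, Function.comp_def]
  simp only [eval, this, hg]
  rfl

/-- Only finitely many cosets have a given weight, so that `cosetGrowth` counts a finite set. -/
theorem finite_setOf_cosetWeight_eq {G : Type*} [Group G] (F : Subgroup G) {S : Set G}
    (hfin : S.Finite) (ω : S → ℕ) (hω : ∀ s, 0 < ω s) (hS : Submonoid.closure S = ⊤) (k : ℕ) :
    {c : RightCosets F | cosetWeight F ω c = k}.Finite := by
  have : Finite S := hfin
  refine ((List.finite_length_le S k).image fun w => rightCoset F (eval w)).subset ?_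
  intro c hc
  obtain ⟨w, hw, hk⟩ := exists_word_of_cosetWeight F ω hS c
  refine ⟨w, ?_, hw⟩
  have h : ∀ w : List S, w.length ≤ wordWeight ω w := by
    intro w
    induction w with
    | nil => simp
    | cons a t ih =>
      have := hω a
      simp only [wordWeight, List.map_cons, List.sum_cons, List.length_cons] at ih ⊢
      omega
  have h2 := h w
  rw [hk, hc] at h2
  exact h2

end CosetGrowth

/-!
Let `T` be a finite right transversal of `Z`. Writing `g = z t` with `z ∈ Z` and `t ∈ T` identifies
the right cosets of `F` with the elements of `(Z ⧸ F) × T`, and a finite automaton with state set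
`T` computes the pair of the class of `z` and the weight while reading a word. By Kleene's theorem
the set `W` of all such pairs for the words ending in a given state is semilinear in `(Z ⧸ F) × ℕ`.
The pairs of a coset and its weight form the lower envelope of `W`, which is semilinear because
semilinear sets in a cancellative monoid are closed under differences.

The growth series of a semilinear set in a cancellative monoid is rational: inclusion–exclusion
reduces this to sets `B + P` with `B` finite and `P` a finitely generated submonoid, and choosing
lexicographically minimal preimages under `ℕⁿ → P` reduces it further to lower sets of `ℕⁿ`, that
is, to Hilbert series of monomial ideals.
-/

namespace CosetGrowth

open scoped Pointwise

section RationalSeries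

/-- The subring of the power series with integer coefficients that are quotients of two
polynomials. -/
def rationalSeries : Subring (PowerSeries ℤ) where
  carrier := {f | IsRational f}
  zero_mem' := ⟨0, 1, one_ne_zero, by simp⟩
  one_mem' := ⟨1, 1, one_ne_zero, by simp⟩
  add_mem' := by
    rintro f g ⟨a, b, hb, hab⟩ ⟨c, d, hd, hcd⟩
    refine ⟨a * d + c * b, b * d, mul_ne_zero hb hd, ?_⟩
    push_cast
    linear_combination (d : PowerSeries ℤ) * hab + (b : PowerSeries ℤ) * hcd
  mul_mem' := by
    rintro f g ⟨a, b, hb, hab⟩ ⟨c, d, hd, hcd⟩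
    refine ⟨a * c, b * d, mul_ne_zero hb hd, ?_⟩
    push_cast
    rw [← hab, ← hcd]
    ring
  neg_mem' := by
    rintro f ⟨a, b, hb, hab⟩
    exact ⟨-a, b, hb, by rw [mul_neg, hab, Polynomial.coe_neg]⟩

theorem X_pow_mem_rationalSeries (n : ℕ) : (PowerSeries.X : PowerSeries ℤ) ^ n ∈ rationalSeries :=
  ⟨X ^ n, 1, one_ne_zero, by simp⟩

theorem mem_rationalSeries_of_coe_mul_mem {q : ℤ[X]} (hq : q ≠ 0) {f : PowerSeries ℤ}
    (h : (q : PowerSeries ℤ) * f ∈ rationalSeries) : f ∈ rationalSeries := by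
  obtain ⟨a, b, hb, hab⟩ := h
  exact ⟨a, b * q, mul_ne_zero hb hq, by rw [Polynomial.coe_mul, mul_assoc, hab]⟩

theorem mem_rationalSeries_of_eq_add_X_pow_mul {n : ℕ} (hn : n ≠ 0) {f g : PowerSeries ℤ}
    (hg : g ∈ rationalSeries) (hfg : f = g + PowerSeries.X ^ n * f) : f ∈ rationalSeries := by
  refine mem_rationalSeries_of_coe_mul_mem (monic_X_pow_sub_C (1 : ℤ) hn).ne_zero ?_
  have h : ((X ^ n - C 1 : ℤ[X]) : PowerSeries ℤ) * f = -g := by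
    push_cast
    rw [map_one]
    linear_combination -hfg
  exact h ▸ neg_mem hg

end RationalSeries

section GrowthSeries

variable {α β : Type*}

/-- The level sets of the weight `h` on `s` are finite. Where this fails, the corresponding
coefficient of `growthSeries h s` is the junk value `0`. -/
def HasFiniteLevels (h : α → ℕ) (s : Set α) : Prop :=
  ∀ k, (s ∩ h ⁻¹' {k}).Finite

/-- The generating function counting the elements of `s` by their weight `h`. -/
noncomputable def growthSeries (h : α → ℕ) (s : Set α) : PowerSeries ℤ :=
  PowerSeries.mk fun k => ((s ∩ h ⁻¹' {k}).ncard : ℤ)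

variable {h : α → ℕ} {s t : Set α}

theorem HasFiniteLevels.mono (ht : HasFiniteLevels h t) (hst : s ⊆ t) : HasFiniteLevels h s :=
  fun k => (ht k).subset (Set.inter_subset_inter_left _ hst)

@[simp]
theorem growthSeries_empty : growthSeries h ∅ = 0 := by
  ext k
  simp [growthSeries]

theorem growthSeries_singleton (a : α) : growthSeries h {a} = PowerSeries.X ^ h a := by
  ext k
  by_cases hk : k = h a
  · simp [growthSeries, hk, Set.inter_eq_left.2]
  · simp [growthSeries, hk, Set.singleton_inter_eq_empty.2, Ne.symm hk, PowerSeries.coeff_X_pow]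

theorem growthSeries_union_add_inter (hs : HasFiniteLevels h s) (ht : HasFiniteLevels h t) :
    growthSeries h (s ∪ t) + growthSeries h (s ∩ t) = growthSeries h s + growthSeries h t := by
  ext k
  simp only [growthSeries, map_add, PowerSeries.coeff_mk]
  rw [Set.union_inter_distrib_right, Set.inter_inter_distrib_right]
  exact_mod_cast Set.ncard_union_add_ncard_inter _ _ (hs k) (ht k)

theorem growthSeries_union (hs : HasFiniteLevels h s) (ht : HasFiniteLevels h t)
    (hst : Disjoint s t) : growthSeries h (s ∪ t) = growthSeries h s + growthSeries h t := by
  rw [← growthSeries_union_add_inter hs ht, hst.inter_eq, growthSeries_empty, add_zero]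

theorem growthSeries_eq_sum_fibers [Fintype β] (hs : HasFiniteLevels h s) (κ : α → β) :
    growthSeries h s = ∑ b, growthSeries h (s ∩ κ ⁻¹' {b}) := by
  ext k
  have hfibers : s ∩ h ⁻¹' {k} = ⋃ b, s ∩ κ ⁻¹' {b} ∩ h ⁻¹' {k} := by
    ext x
    simp
  have hdisj : Pairwise (Function.onFun Disjoint fun b => s ∩ κ ⁻¹' {b} ∩ h ⁻¹' {k}) :=
    fun b b' hbb' => Set.disjoint_left.2 fun x hx hx' => hbb' (hx.1.2.symm.trans hx'.1.2)
  simp only [growthSeries, map_sum, PowerSeries.coeff_mk]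
  rw [hfibers, Set.ncard_iUnion_of_finite (fun b => hs.mono Set.inter_subset_left k) hdisj,
    finsum_eq_sum_of_fintype, Nat.cast_sum]

section Image

variable {h' : β → ℕ} {c : ℕ} {f : β → α} {s : Set β}

theorem image_inter_preimage_add_singleton (hc : ∀ x ∈ s, h (f x) = c + h' x) (k : ℕ) :
    f '' s ∩ h ⁻¹' {c + k} = f '' (s ∩ h' ⁻¹' {k}) := by
  have hlevel : s ∩ f ⁻¹' (h ⁻¹' {c + k}) = s ∩ h' ⁻¹' {k} := by
    ext x
    refine and_congr_right fun hx => ?_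
    simp [hc x hx]
  rw [← Set.image_inter_preimage, hlevel]

theorem image_inter_preimage_singleton_of_lt (hc : ∀ x ∈ s, h (f x) = c + h' x) {k : ℕ}
    (hk : k < c) : f '' s ∩ h ⁻¹' {k} = ∅ := by
  rw [Set.eq_empty_iff_forall_notMem]
  rintro _ ⟨⟨x, hx, rfl⟩, hxk⟩
  exact hk.not_ge (Nat.le.intro ((hc x hx).symm.trans hxk))

theorem hasFiniteLevels_image_iff (hf : Set.InjOn f s) (hc : ∀ x ∈ s, h (f x) = c + h' x) :
    HasFiniteLevels h (f '' s) ↔ HasFiniteLevels h' s := by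
  refine ⟨fun hs k => ?_, fun hs k => ?_⟩
  · have hk := hs (c + k)
    rw [image_inter_preimage_add_singleton hc] at hk
    exact hk.of_finite_image (hf.mono Set.inter_subset_left)
  · rcases lt_or_ge k c with hk | hk
    · simp [image_inter_preimage_singleton_of_lt hc hk]
    · obtain ⟨k, rfl⟩ := exists_add_of_le hk
      rw [image_inter_preimage_add_singleton hc]
      exact (hs k).image f

theorem growthSeries_image (hf : Set.InjOn f s) (hc : ∀ x ∈ s, h (f x) = c + h' x) :
    growthSeries h (f '' s) = PowerSeries.X ^ c * growthSeries h' s := by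
  ext k
  rw [PowerSeries.coeff_X_pow_mul']
  simp only [growthSeries, PowerSeries.coeff_mk]
  split_ifs with hk
  · obtain ⟨k, rfl⟩ := exists_add_of_le hk
    rw [image_inter_preimage_add_singleton hc, Nat.add_sub_cancel_left,
      (hf.mono Set.inter_subset_left).ncard_image]
  · rw [image_inter_preimage_singleton_of_lt hc (not_le.1 hk), Set.ncard_empty, Nat.cast_zero]

end Image

theorem growthSeries_biUnion_mem {ι : Type*} {R : AddSubgroup (PowerSeries ℤ)}
    {C : Set (Set α)} (hC : InfClosed C)
    (hR : ∀ s ∈ C, HasFiniteLevels h s → growthSeries h s ∈ R) (T : Finset ι) {f : ι → Set α}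
    (hf : ∀ i ∈ T, f i ∈ C) (hfin : HasFiniteLevels h (⋃ i ∈ T, f i)) :
    growthSeries h (⋃ i ∈ T, f i) ∈ R := by
  classical
  induction T using Finset.induction_on generalizing f with
  | empty => simp [zero_mem]
  | insert i T _ ih =>
    have hi : f i ∈ C := hf i (T.mem_insert_self i)
    have hT : ∀ j ∈ T, f j ∈ C := fun j hj => hf j (Finset.mem_insert_of_mem hj)
    rw [Finset.set_biUnion_insert] at hfin ⊢
    have hfini : HasFiniteLevels h (f i) := hfin.mono Set.subset_union_left
    have hfinT : HasFiniteLevels h (⋃ j ∈ T, f j) := hfin.mono Set.subset_union_right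
    rw [eq_sub_of_add_eq (growthSeries_union_add_inter hfini hfinT)]
    refine sub_mem (add_mem (hR _ hi hfini) (ih hT hfinT)) ?_
    have hinter := hfini.mono (Set.inter_subset_left (t := ⋃ j ∈ T, f j))
    rw [Set.inter_iUnion₂] at hinter ⊢
    exact ih (fun j hj => hC hi (hT j hj)) hinter

end GrowthSeries

section LowerSet

theorem wellFoundedLT_lowerSet {α : Type*} [Preorder α] [WellQuasiOrderedLE α] :
    WellFoundedLT (LowerSet α) := by
  refine ⟨RelEmbedding.wellFounded_iff_isEmpty.2 ⟨fun D => ?_⟩⟩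
  have hanti : StrictAnti D := fun _ _ hmn => D.map_rel_iff.2 hmn
  have hdrop : ∀ n, ∃ x, x ∈ D n ∧ x ∉ D (n + 1) := fun n =>
    Set.not_subset.1 (hanti n.lt_succ_self).not_ge
  choose x hx hx' using hdrop
  obtain ⟨m, n, hmn, hle⟩ := wellQuasiOrdered_le x
  exact hx' m ((D (m + 1)).lower hle (hanti.antitone (Nat.succ_le_of_lt hmn) (hx n)))

variable {ι : Type*}

/-- The part of a lower set of `ι → ℕ` on the coordinate hyperplane `x i = 0`. -/
def zeroSlice (D : LowerSet (ι → ℕ)) (i : ι) : LowerSet (ι → ℕ) where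
  carrier := {x | x ∈ D ∧ x i = 0}
  lower' _ _ hyx hx := ⟨D.lower hyx hx.1, Nat.le_zero.1 (hx.2 ▸ hyx i)⟩

theorem zeroSlice_le (D : LowerSet (ι → ℕ)) (i : ι) : zeroSlice D i ≤ D :=
  fun _ hx => hx.1

section Shift

variable [DecidableEq ι]

/-- The lower set of all `x` with `x + eᵢ ∈ D`; in terms of monomial ideals, passing to the
complement of the colon ideal by the `i`-th variable. -/
def shift (D : LowerSet (ι → ℕ)) (i : ι) : LowerSet (ι → ℕ) where
  carrier := {x | x + Pi.single i 1 ∈ D}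
  lower' _ _ hyx hx := D.lower (add_le_add_left hyx _) hx

theorem mem_shift {D : LowerSet (ι → ℕ)} {i : ι} {x : ι → ℕ} :
    x ∈ shift D i ↔ x + Pi.single i 1 ∈ D := Iff.rfl

theorem shift_le (D : LowerSet (ι → ℕ)) (i : ι) : shift D i ≤ D :=
  fun _ hx => D.lower le_self_add hx

theorem zeroSlice_union_shift (D : LowerSet (ι → ℕ)) (i : ι) :
    (zeroSlice D i : Set (ι → ℕ)) ∪ (· + Pi.single i 1) '' (shift D i : Set (ι → ℕ)) = D := by
  refine subset_antisymm (Set.union_subset (zeroSlice_le D i) ?_) fun x hx => ?_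
  · rintro _ ⟨y, hy, rfl⟩
    exact hy
  · by_cases hxi : x i = 0
    · exact Or.inl ⟨hx, hxi⟩
    · have hle : Pi.single i 1 ≤ x := update_le_iff.2
        ⟨Nat.one_le_iff_ne_zero.2 hxi, fun j _ => Nat.zero_le (x j)⟩
      refine Or.inr ⟨x - Pi.single i 1, ?_, tsub_add_cancel_of_le hle⟩
      rwa [SetLike.mem_coe, mem_shift, tsub_add_cancel_of_le hle]

theorem disjoint_zeroSlice_image_add_single (D : LowerSet (ι → ℕ)) (i : ι) (s : Set (ι → ℕ)) :
    Disjoint (zeroSlice D i : Set (ι → ℕ)) ((· + Pi.single i 1) '' s) := by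
  rw [Set.disjoint_right]
  rintro _ ⟨y, -, rfl⟩ ⟨-, hy⟩
  simp at hy

theorem growthSeries_lowerSet_eq (h : (ι → ℕ) →+ ℕ) {D : LowerSet (ι → ℕ)}
    (hD : HasFiniteLevels h (D : Set (ι → ℕ))) (i : ι) :
    growthSeries h (D : Set (ι → ℕ)) = growthSeries h (zeroSlice D i : Set (ι → ℕ)) +
      PowerSeries.X ^ h (Pi.single i 1) * growthSeries h (shift D i : Set (ι → ℕ)) := by
  have hD' := hD
  rw [← zeroSlice_union_shift D i] at hD'
  conv_lhs => rw [← zeroSlice_union_shift D i]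
  rw [growthSeries_union (hD'.mono Set.subset_union_left) (hD'.mono Set.subset_union_right)
      (disjoint_zeroSlice_image_add_single D i _),
    growthSeries_image (add_left_injective _).injOn fun x _ => (map_add h _ _).trans (add_comm _ _)]

theorem map_single_ne_zero_of_shift_eq (h : (ι → ℕ) →+ ℕ) {D : LowerSet (ι → ℕ)}
    (hD : HasFiniteLevels h (D : Set (ι → ℕ))) (hne : (D : Set (ι → ℕ)).Nonempty) {i : ι}
    (hi : shift D i = D) : h (Pi.single i 1) ≠ 0 := by
  intro hzero
  obtain ⟨x, hx⟩ := hne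
  have hline : ∀ n : ℕ, x + n • Pi.single i 1 ∈ D := by
    intro n
    induction n with
    | zero => simpa using hx
    | succ n ih =>
      rw [← hi, mem_shift, add_assoc, ← succ_nsmul] at ih
      exact ih
  have hlevel : ∀ n : ℕ, x + n • Pi.single i 1 ∈ (D : Set (ι → ℕ)) ∩ h ⁻¹' {h x} :=
    fun n => ⟨hline n, by
      rw [Set.mem_preimage, map_add, map_nsmul, hzero, smul_zero, add_zero]; rfl⟩
  have hinj : Function.Injective fun n : ℕ => x + n • Pi.single i 1 := fun m n hmn => by
    simpa using congrFun (add_left_cancel hmn) i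
  exact Set.infinite_of_injective_forall_mem hinj hlevel (hD (h x))

end Shift

theorem growthSeries_lowerSet_mem_rationalSeries [Finite ι] (h : (ι → ℕ) →+ ℕ)
    (D : LowerSet (ι → ℕ)) (hD : HasFiniteLevels h (D : Set (ι → ℕ))) :
    growthSeries h (D : Set (ι → ℕ)) ∈ rationalSeries := by
  classical
  have := wellFoundedLT_lowerSet (α := ι → ℕ)
  induction D using WellFoundedLT.induction with
  | ind D ih =>
    rcases (D : Set (ι → ℕ)).eq_empty_or_nonempty with hempty | hne
    · rw [hempty, growthSeries_empty]
      exact zero_mem _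
    by_cases hzero : ∀ i, zeroSlice D i = D
    · have hsub : (D : Set (ι → ℕ)) ⊆ {0} := fun x hx =>
        funext fun i => ((hzero i).ge hx).2
      rw [hne.subset_singleton_iff.1 hsub, growthSeries_singleton]
      exact X_pow_mem_rationalSeries _
    push Not at hzero
    obtain ⟨i, hi⟩ := hzero
    have hslice : growthSeries h (zeroSlice D i : Set (ι → ℕ)) ∈ rationalSeries :=
      ih _ ((zeroSlice_le D i).lt_of_ne hi) (hD.mono (zeroSlice_le D i))
    have heq := growthSeries_lowerSet_eq h hD i
    rcases (shift_le D i).eq_or_lt with hshift | hshift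
    · rw [hshift] at heq
      exact mem_rationalSeries_of_eq_add_X_pow_mul
        (map_single_ne_zero_of_shift_eq h hD hne hshift) hslice heq
    · rw [heq]
      exact add_mem hslice (mul_mem (X_pow_mem_rationalSeries _)
        (ih _ hshift (hD.mono (shift_le D i))))

end LowerSet

section HybridLinear

variable {M : Type*} [AddCommMonoid M]

/-- A hybrid linear set `B + P`: a finite union of translates of one finitely generated
submonoid `P`. Unlike linear sets, these are closed under intersection. -/
def IsHybridLinear (s : Set M) : Prop :=
  ∃ (B : Set M) (P : AddSubmonoid M), B.Finite ∧ P.FG ∧ B + (P : Set M) = s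

theorem isHybridLinear_of_isLinearSet {s : Set M} (hs : IsLinearSet s) : IsHybridLinear s := by
  obtain ⟨a, P, hP, rfl⟩ := isLinearSet_iff_exists_fg_eq_vadd.1 hs
  exact ⟨{a}, P, Set.finite_singleton a, hP, Set.singleton_add⟩

theorem mem_add_mrange {N : Type*} [AddCommMonoid N] {f : N →+ M} {B : Set M} {z : M} :
    z ∈ B + (AddMonoidHom.mrange f : Set M) ↔ ∃ b ∈ B, ∃ x, b + f x = z := by
  simp [Set.mem_add]

section Inter

variable {m n : ℕ} (f : (Fin m → ℕ) →+ M) (g : (Fin n → ℕ) →+ M)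

/-- The minimal solutions of `b + f x = c + g y`, which generate all solutions over those of the
homogeneous equation `f x = g y`. -/
def minimalSolutions (b c : M) : Set ((Fin m → ℕ) × (Fin n → ℕ)) :=
  {u | Minimal (fun u => b + f u.1 = c + g u.2) u}

theorem finite_minimalSolutions (b c : M) : (minimalSolutions f g b c).Finite :=
  (setOfPred_minimal_antichain _).finite_of_partiallyWellOrderedOn
    (Set.isPWO_of_wellQuasiOrderedLE _)

theorem fg_inf_mrange [IsCancelAdd M] :
    (AddMonoidHom.mrange f ⊓ AddMonoidHom.mrange g).FG := by
  let f' := f.comp (AddMonoidHom.fst (Fin m → ℕ) (Fin n → ℕ))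
  let g' := g.comp (AddMonoidHom.snd (Fin m → ℕ) (Fin n → ℕ))
  have heq : AddMonoidHom.mrange f ⊓ AddMonoidHom.mrange g = (f'.eqLocusM g').map f' := by
    ext z
    constructor
    · rintro ⟨⟨x, rfl⟩, y, hy⟩
      exact ⟨(x, y), hy.symm, rfl⟩
    · rintro ⟨⟨x, y⟩, hxy, rfl⟩
      exact ⟨⟨x, rfl⟩, y, hxy.symm⟩
  exact heq ▸ (AddSubmonoid.fg_eqLocusM f' g').map f'

theorem add_mrange_inter_add_mrange [IsCancelAdd M] (B C : Set M) :
    (B + (AddMonoidHom.mrange f : Set M)) ∩ (C + (AddMonoidHom.mrange g : Set M)) =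
      (⋃ b ∈ B, ⋃ c ∈ C, (fun u => b + f u.1) '' minimalSolutions f g b c) +
        ((AddMonoidHom.mrange f ⊓ AddMonoidHom.mrange g : AddSubmonoid M) : Set M) := by
  ext z
  constructor
  · rintro ⟨hzf, hzg⟩
    obtain ⟨b, hb, x, rfl⟩ := mem_add_mrange.1 hzf
    obtain ⟨c, hc, y, hxy⟩ := mem_add_mrange.1 hzg
    obtain ⟨u, hle, hmin⟩ := exists_minimal_le_of_wellFoundedLT
      (fun u : (Fin m → ℕ) × (Fin n → ℕ) => b + f u.1 = c + g u.2) (x, y) hxy.symm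
    obtain ⟨v, rfl⟩ := exists_add_of_le hle.1
    obtain ⟨w, rfl⟩ := exists_add_of_le hle.2
    have hu : b + f u.1 = c + g u.2 := hmin.prop
    have hvw : g w = f v := by
      rw [map_add, map_add, ← add_assoc, ← add_assoc, hu] at hxy
      exact add_left_cancel hxy
    refine Set.mem_add.2 ⟨b + f u.1, Set.mem_biUnion hb (Set.mem_biUnion hc ⟨u, hmin, rfl⟩),
      f v, ⟨⟨v, rfl⟩, w, hvw⟩, ?_⟩
    rw [map_add, add_assoc]
  · intro hz
    obtain ⟨a, ha, _, ⟨⟨v, rfl⟩, w, hvw⟩, rfl⟩ := Set.mem_add.1 hz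
    obtain ⟨b, hb, ha⟩ := Set.mem_iUnion₂.1 ha
    obtain ⟨c, hc, u, hmin, rfl⟩ := Set.mem_iUnion₂.1 ha
    have hu : b + f u.1 = c + g u.2 :=
      Minimal.prop (P := fun u : (Fin m → ℕ) × (Fin n → ℕ) => b + f u.1 = c + g u.2) hmin
    refine ⟨mem_add_mrange.2 ⟨b, hb, u.1 + v, ?_⟩, mem_add_mrange.2 ⟨c, hc, u.2 + w, ?_⟩⟩
    · rw [map_add, add_assoc]
    · rw [map_add, hvw, ← add_assoc, ← hu]

end Inter

theorem infClosed_isHybridLinear [IsCancelAdd M] : InfClosed {s : Set M | IsHybridLinear s} := by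
  rintro _ ⟨B, P, hB, hP, rfl⟩ _ ⟨C, Q, hC, hQ, rfl⟩
  obtain ⟨m, f, rfl⟩ := AddSubmonoid.fg_iff_exists_fin_addMonoidHom.1 hP
  obtain ⟨n, g, rfl⟩ := AddSubmonoid.fg_iff_exists_fin_addMonoidHom.1 hQ
  have hfin := hB.biUnion fun b _ => hC.biUnion fun c _ =>
    (finite_minimalSolutions f g b c).image fun u => b + f u.1
  exact ⟨_, _, hfin, fg_inf_mrange f g, (add_mrange_inter_add_mrange f g B C).symm⟩

section StandardReps

variable {n : ℕ} (f : (Fin n → ℕ) →+ M) (b : M) (B : Set M)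

/-- The lexicographically smallest representatives `x` of the points `b + f x` outside
`B + range f`; they play the role of the standard monomials of a Gröbner basis, and the point is
that they form a lower set. -/
def standardReps : LowerSet (Fin n → ℕ) where
  carrier := {x | b + f x ∉ B + (AddMonoidHom.mrange f : Set M) ∧
    ∀ y, toLex y < toLex x → b + f y ≠ b + f x}
  lower' := by
    rintro x y hyx ⟨hxB, hxmin⟩
    obtain ⟨z, rfl⟩ := exists_add_of_le hyx
    refine ⟨fun hy => hxB ?_, fun u hu huy => hxmin (u + z) (add_lt_add_left hu (toLex z)) ?_⟩
    · obtain ⟨c, hc, v, hv⟩ := mem_add_mrange.1 hy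
      exact mem_add_mrange.2 ⟨c, hc, v + z, by rw [map_add, ← add_assoc, hv, map_add, add_assoc]⟩
    · rw [map_add, map_add, ← add_assoc, huy, add_assoc]

theorem injOn_standardReps :
    Set.InjOn (fun x => b + f x) (standardReps f b B : Set (Fin n → ℕ)) := by
  intro x hx y hy hxy
  rcases lt_trichotomy (toLex x) (toLex y) with hlt | heq | hlt
  · exact absurd hxy (hy.2 x hlt)
  · exact toLex_inj.1 heq
  · exact absurd hxy.symm (hx.2 y hlt)

theorem disjoint_image_standardReps : Disjoint (B + (AddMonoidHom.mrange f : Set M))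
    ((fun x => b + f x) '' (standardReps f b B : Set (Fin n → ℕ))) := by
  rw [Set.disjoint_right]
  rintro _ ⟨x, hx, rfl⟩
  exact hx.1

theorem insert_add_mrange : insert b B + (AddMonoidHom.mrange f : Set M) =
    (B + (AddMonoidHom.mrange f : Set M)) ∪
      (fun x => b + f x) '' (standardReps f b B : Set (Fin n → ℕ)) := by
  ext z
  simp only [Set.mem_union, mem_add_mrange, Set.exists_mem_insert]
  constructor
  · rintro (⟨x, rfl⟩ | hz)
    · by_cases hx : b + f x ∈ B + (AddMonoidHom.mrange f : Set M)
      · exact Or.inl (mem_add_mrange.1 hx)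
      · obtain ⟨y, hy, hmin⟩ := WellFounded.has_min
          (wellFounded_lt (α := Lex (Fin n → ℕ))) {y | b + f (ofLex y) = b + f x} ⟨toLex x, rfl⟩
        replace hy : b + f (ofLex y) = b + f x := hy
        exact Or.inr ⟨ofLex y, ⟨by rwa [hy], fun u hu huy => hmin (toLex u) (huy.trans hy) hu⟩, hy⟩
    · exact Or.inl hz
  · rintro (hz | ⟨x, -, rfl⟩)
    · exact Or.inr hz
    · exact Or.inl ⟨x, rfl⟩

end StandardReps

theorem growthSeries_add_mrange_mem_rationalSeries (h : M →+ ℕ) {n : ℕ} (f : (Fin n → ℕ) →+ M)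
    {B : Set M} (hB : B.Finite) (hfin : HasFiniteLevels h (B + (AddMonoidHom.mrange f : Set M))) :
    growthSeries h (B + (AddMonoidHom.mrange f : Set M)) ∈ rationalSeries := by
  induction B, hB using Set.Finite.induction_on with
  | empty =>
    rw [Set.empty_add, growthSeries_empty]
    exact zero_mem _
  | @insert b B _ _ ih =>
    have hinj := injOn_standardReps f b B
    have hweight : ∀ x ∈ standardReps f b B, h (b + f x) = h b + h.comp f x :=
      fun x _ => map_add h b (f x)
    rw [insert_add_mrange] at hfin ⊢
    have hfinB := hfin.mono Set.subset_union_left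
    have hfinNew := hfin.mono Set.subset_union_right
    rw [growthSeries_union hfinB hfinNew (disjoint_image_standardReps f b B),
      growthSeries_image hinj hweight]
    have hfinReps := (hasFiniteLevels_image_iff hinj hweight).1 hfinNew
    exact add_mem (ih hfinB) (mul_mem (X_pow_mem_rationalSeries _)
      (growthSeries_lowerSet_mem_rationalSeries _ _ hfinReps))

theorem growthSeries_mem_rationalSeries_of_isSemilinearSet [IsCancelAdd M] (h : M →+ ℕ)
    {s : Set M} (hs : IsSemilinearSet s) (hfin : HasFiniteLevels h s) :
    growthSeries h s ∈ rationalSeries := by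
  obtain ⟨T, hT, rfl⟩ := isSemilinearSet_iff.1 hs
  rw [Set.sUnion_eq_biUnion] at hfin ⊢
  refine growthSeries_biUnion_mem (R := rationalSeries.toAddSubgroup) infClosed_isHybridLinear ?_ T
    (fun t ht => isHybridLinear_of_isLinearSet (hT t ht)) hfin
  rintro _ ⟨B, P, hB, hP, rfl⟩ hfinBP
  obtain ⟨n, f, rfl⟩ := AddSubmonoid.fg_iff_exists_fin_addMonoidHom.1 hP
  exact growthSeries_add_mrange_mem_rationalSeries h f hB hfinBP

end HybridLinear

theorem isSemilinearSet_lowerEnvelope {N : Type*} [AddCommMonoid N] [IsCancelAdd N]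
    {W : Set (N × ℕ)} (hW : IsSemilinearSet W) :
    IsSemilinearSet {x ∈ W | ∀ k < x.2, (x.1, k) ∉ W} := by
  have hpos : IsSemilinearSet
      ({((0 : N), 1)} + (AddSubmonoid.closure {((0 : N), 1)} : Set (N × ℕ))) :=
    (IsSemilinearSet.singleton _).add (.closure_of_finite (Set.finite_singleton _))
  -- `W + {(0, k) | 0 < k}` consists of the points strictly above a point of `W`.
  convert hW.sdiff (hW.add hpos) using 1
  ext ⟨x, l⟩
  refine and_congr_right fun _ => not_iff_not.1 ?_
  push Not
  constructor
  · rintro ⟨k, hk, hxk⟩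
    obtain ⟨d, rfl⟩ := Nat.exists_eq_add_of_lt hk
    refine ⟨_, hxk, _, ⟨_, rfl, _, AddSubmonoid.mem_closure_singleton.2 ⟨d, rfl⟩, rfl⟩, ?_⟩
    ext
    · simp
    · simp; omega
  · rintro ⟨⟨y, k⟩, hyk, _, ⟨_, rfl, _, hc, rfl⟩, hx⟩
    obtain ⟨d, rfl⟩ := AddSubmonoid.mem_closure_singleton.1 hc
    simp only [Prod.smul_mk, smul_zero, smul_eq_mul, mul_one, Prod.mk_add_mk, add_zero,
      Prod.mk.injEq] at hx
    obtain ⟨rfl, rfl⟩ := hx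
    exact ⟨k, by omega, hyk⟩

section Walks

variable {Q M : Type*} [AddCommMonoid M]

/-- `WalkSum E A p q m`: the element `m` is the sum of the labels along a nonempty walk from `p`
to `q` all of whose intermediate vertices lie in `A`, where `E p q` is the set of labels of the
edges from `p` to `q`. -/
inductive WalkSum (E : Q → Q → Set M) (A : Set Q) (p : Q) : Q → M → Prop
  | edge {q m} : m ∈ E p q → WalkSum E A p q m
  | snoc {r q m m'} : WalkSum E A p r m → r ∈ A → m' ∈ E r q → WalkSum E A p q (m + m')

namespace WalkSum

variable {E : Q → Q → Set M} {A : Set Q} {a p q r : Q} {m c x : M}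

theorem mono {A' : Set Q} (hA : A ⊆ A') (h : WalkSum E A p q m) : WalkSum E A' p q m := by
  induction h with
  | edge hm => exact edge hm
  | snoc _ hr hm ih => exact ih.snoc (hA hr) hm

theorem trans (hx : WalkSum E A p r x) (hr : r ∈ A) (hm : WalkSum E A r q m) :
    WalkSum E A p q (x + m) := by
  induction hm with
  | edge hm => exact hx.snoc hr hm
  | snoc _ hr' hm ih => exact add_assoc x _ _ ▸ ih.snoc hr' hm

theorem add_closure (hx : WalkSum E A p a x) (ha : a ∈ A)
    (hc : c ∈ AddSubmonoid.closure {m | WalkSum E A a a m}) : WalkSum E A p a (x + c) := by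
  induction hc using AddSubmonoid.closure_induction generalizing x with
  | mem c hc => exact hx.trans ha hc
  | zero => rwa [add_zero]
  | add c d _ _ hc hd => exact add_assoc x c d ▸ hd (hc hx)

theorem setOf_insert : {m | WalkSum E (insert a A) p q m} = {m | WalkSum E A p q m} ∪
    ({m | WalkSum E A p a m} + (AddSubmonoid.closure {m | WalkSum E A a a m} : Set M) +
      {m | WalkSum E A a q m}) := by
  refine subset_antisymm (fun m hm => ?_) (Set.union_subset
    (fun m hm => mono (Set.subset_insert a A) hm) ?_)
  · induction hm with
    | edge hm => exact Or.inl (edge hm)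
    | @snoc r q m m' _ hr hm' ih =>
      rcases ih with hm | ⟨_, ⟨x, hx, c, hc, rfl⟩, y, hy, rfl⟩ <;> rcases hr with rfl | hr
      · exact Or.inr ⟨m, ⟨m, hm, 0, zero_mem _, add_zero m⟩, m', edge hm', rfl⟩
      · exact Or.inl (hm.snoc hr hm')
      · have hcy := add_mem hc (AddSubmonoid.subset_closure hy)
        exact Or.inr ⟨x + (c + y), ⟨x, hx, c + y, hcy, rfl⟩, m', edge hm', by
          simp only [add_assoc]⟩
      · exact Or.inr ⟨x + c, ⟨x, hx, c, hc, rfl⟩, y + m', hy.snoc hr hm',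
          (add_assoc _ _ _).symm⟩
  · rintro _ ⟨_, ⟨x, hx, c, hc, rfl⟩, y, hy, rfl⟩
    have hsub := Set.subset_insert a A
    have hc' := AddSubmonoid.closure_mono (fun _ => mono hsub) hc
    exact ((hx.mono hsub).add_closure (Set.mem_insert a A) hc').trans (Set.mem_insert a A)
      (hy.mono hsub)

/-- **Kleene's theorem** in a commutative monoid. -/
theorem isSemilinearSet (hE : ∀ p q, IsSemilinearSet (E p q)) (hA : A.Finite) (p q : Q) :
    IsSemilinearSet {m | WalkSum E A p q m} := by
  induction A, hA using Set.Finite.induction_on generalizing p q with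
  | empty =>
    convert hE p q using 1
    ext m
    refine ⟨?_, edge⟩
    rintro (hm | ⟨-, hr, -⟩)
    · exact hm
    · exact absurd hr (Set.notMem_empty _)
  | @insert a A _ _ ih =>
    rw [setOf_insert]
    exact (ih p q).union (((ih p a).add (ih a a).closure).add (ih a q))

end WalkSum

section Automaton

variable {S : Type*} {δ : Q → S → Q} {l : Q → S → M} {state : List S → Q} {label : List S → M}

/-- The labels of the edges from `p` to `q` in the graph of an automaton with transition function
`δ` that outputs `l p s` when it reads the letter `s` in the state `p`. -/
def edgeLabels (δ : Q → S → Q) (l : Q → S → M) (p q : Q) : Set M :=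
  l p '' {s | δ p s = q}

theorem eq_nil_or_walkSum_of_word (hstate : ∀ w s, state (w ++ [s]) = δ (state w) s)
    (hnil : label [] = 0) (hlabel : ∀ w s, label (w ++ [s]) = label w + l (state w) s)
    (w : List S) :
    w = [] ∨ WalkSum (edgeLabels δ l) Set.univ (state []) (state w) (label w) := by
  have hedge : ∀ w s, l (state w) s ∈ edgeLabels δ l (state w) (state (w ++ [s])) :=
    fun w s => ⟨s, (hstate w s).symm, rfl⟩
  induction w using List.reverseRecOn with
  | nil => exact Or.inl rfl
  | append_singleton w s ih =>
    rw [hlabel]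
    rcases ih with rfl | hw
    · rw [hnil, zero_add]
      exact Or.inr (.edge (hedge [] s))
    · exact Or.inr (hw.snoc (Set.mem_univ _) (hedge w s))

theorem exists_word_of_walkSum (hstate : ∀ w s, state (w ++ [s]) = δ (state w) s)
    (hnil : label [] = 0) (hlabel : ∀ w s, label (w ++ [s]) = label w + l (state w) s)
    {q : Q} {m : M} (hm : WalkSum (edgeLabels δ l) Set.univ (state []) q m) :
    ∃ w, state w = q ∧ label w = m := by
  induction hm with
  | edge hm =>
    obtain ⟨s, rfl, rfl⟩ := hm
    exact ⟨[] ++ [s], hstate [] s, by rw [hlabel, hnil, zero_add]⟩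
  | snoc _ _ hm ih =>
    obtain ⟨w, rfl, rfl⟩ := ih
    obtain ⟨s, rfl, rfl⟩ := hm
    exact ⟨w ++ [s], hstate w s, hlabel w s⟩

theorem isSemilinearSet_word_labels [Finite Q] [Finite S]
    (hstate : ∀ w s, state (w ++ [s]) = δ (state w) s) (hnil : label [] = 0)
    (hlabel : ∀ w s, label (w ++ [s]) = label w + l (state w) s) (q : Q) :
    IsSemilinearSet {m | ∃ w, state w = q ∧ label w = m} := by
  have hwalks : IsSemilinearSet {m | WalkSum (edgeLabels δ l) Set.univ (state []) q m} :=
    WalkSum.isSemilinearSet (fun _ _ => .of_finite ((Set.toFinite _).image _)) Set.finite_univ _ q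
  have hempty : IsSemilinearSet {m ∈ ({0} : Set M) | state [] = q} :=
    .of_finite ((Set.finite_singleton 0).subset (Set.sep_subset _ _))
  convert hwalks.union hempty using 1
  ext m
  constructor
  · rintro ⟨w, rfl, rfl⟩
    rcases eq_nil_or_walkSum_of_word hstate hnil hlabel w with rfl | hw
    · exact Or.inr ⟨hnil, rfl⟩
    · exact Or.inl hw
  · rintro (hm | ⟨rfl, hq⟩)
    · exact exists_word_of_walkSum hstate hnil hlabel hm
    · exact ⟨[], hq, hnil⟩

end Automaton

end Walks

section Cosets

variable {G : Type*} [Group G] {S : Set G} {ω : S → ℕ} {F : Subgroup G}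

theorem cosetWeight_le {c : RightCosets F} {w : List S} (hw : rightCoset F (eval w) = c) :
    cosetWeight F ω c ≤ wordWeight ω w :=
  Nat.sInf_le ⟨w, hw, rfl⟩

theorem cosetGrowthSeries_eq_growthSeries :
    cosetGrowthSeries F ω = growthSeries (cosetWeight F ω) Set.univ := by
  simp only [growthSeries, Set.univ_inter]
  rfl

theorem hasFiniteLevels_cosetWeight (hfin : S.Finite) (hS : Submonoid.closure S = ⊤)
    (hω : ∀ s, 0 < ω s) (A : Set (RightCosets F)) : HasFiniteLevels (cosetWeight F ω) A :=
  fun k => (finite_setOf_cosetWeight_eq F hfin ω hω hS k).subset Set.inter_subset_right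

section Coordinates

variable {Q N : Type*} {φ : RightCosets F → Q × N}

theorem image_cosetWeight_eq_lowerEnvelope (hS : Submonoid.closure S = ⊤)
    (hφ : Function.Injective φ) {q : Q} {W : Set (N × ℕ)}
    (hW : W = {x | ∃ w : List S, (φ (rightCoset F (eval w))).1 = q ∧
      ((φ (rightCoset F (eval w))).2, wordWeight ω w) = x}) :
    (fun c => ((φ c).2, cosetWeight F ω c)) '' {c | (φ c).1 = q} =
      {x ∈ W | ∀ k < x.2, (x.1, k) ∉ W} := by
  subst hW
  ext ⟨x, k⟩
  constructor
  · rintro ⟨c, rfl, heq⟩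
    obtain ⟨rfl, rfl⟩ := Prod.mk.inj heq
    obtain ⟨w, rfl, hw⟩ := exists_word_of_cosetWeight F ω hS c
    refine ⟨⟨w, rfl, by rw [hw]⟩, ?_⟩
    rintro k hlt ⟨v, hvq, hvk⟩
    obtain ⟨hvN, rfl⟩ := Prod.mk.inj hvk
    exact (cosetWeight_le (hφ (Prod.ext hvq hvN))).not_gt hlt
  · rintro ⟨⟨w, rfl, hw⟩, hmin⟩
    obtain ⟨rfl, rfl⟩ := Prod.mk.inj hw
    obtain ⟨v, hv, hvk⟩ := exists_word_of_cosetWeight F ω hS (rightCoset F (eval w))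
    have hle : wordWeight ω w ≤ cosetWeight F ω (rightCoset F (eval w)) :=
      not_lt.1 fun hlt => hmin _ hlt ⟨v, by rw [hv], by rw [hv, hvk]⟩
    exact ⟨_, rfl, by rw [hle.antisymm (cosetWeight_le rfl)]⟩

theorem isRational_cosetGrowthSeries_of_isSemilinearSet [Finite Q] [AddCommMonoid N]
    [IsCancelAdd N] (hfin : S.Finite) (hS : Submonoid.closure S = ⊤) (hω : ∀ s, 0 < ω s)
    (hφ : Function.Injective φ)
    (hsemi : ∀ q, IsSemilinearSet {x : N × ℕ | ∃ w : List S,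
      (φ (rightCoset F (eval w))).1 = q ∧ ((φ (rightCoset F (eval w))).2, wordWeight ω w) = x}) :
    IsRational (cosetGrowthSeries F ω) := by
  have := Fintype.ofFinite Q
  have hlevels := hasFiniteLevels_cosetWeight (F := F) hfin hS hω
  rw [cosetGrowthSeries_eq_growthSeries,
    growthSeries_eq_sum_fibers (hlevels _) fun c => (φ c).1]
  refine sum_mem (S := rationalSeries) fun q _ => ?_
  rw [Set.univ_inter]
  let graph : RightCosets F → N × ℕ := fun c => ((φ c).2, cosetWeight F ω c)
  let fiber : Set (RightCosets F) := {c | (φ c).1 = q}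
  have hinj : Set.InjOn graph fiber := fun c hc d hd hcd =>
    hφ (Prod.ext (hc.trans hd.symm) (congrArg Prod.fst hcd))
  have hweight : ∀ c ∈ fiber, AddMonoidHom.snd N ℕ (graph c) = 0 + cosetWeight F ω c :=
    fun _ _ => (zero_add _).symm
  have hgraph : IsSemilinearSet (graph '' fiber) :=
    image_cosetWeight_eq_lowerEnvelope hS hφ rfl ▸ isSemilinearSet_lowerEnvelope (hsemi q)
  have hrational := growthSeries_mem_rationalSeries_of_isSemilinearSet _ hgraph
    ((hasFiniteLevels_image_iff hinj hweight).2 (hlevels fiber))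
  rwa [growthSeries_image hinj hweight, pow_zero, one_mul] at hrational

end Coordinates

section Position

open scoped IsMulCommutative

variable {Z : Subgroup G} [IsMulCommutative Z] {T : Set G}
  (hT : Subgroup.IsComplement (Z : Set G) T) (hF : F ≤ Z)

include hF in
theorem rightCoset_eq_iff_equiv (g g' : G) :
    rightCoset F g = rightCoset F g' ↔ (hT.equiv g).2 = (hT.equiv g').2 ∧
      ((hT.equiv g).1 : Z ⧸ F.subgroupOf Z) = (hT.equiv g').1 := by
  have hcoset : rightCoset F g = rightCoset F g' ↔ g' * g⁻¹ ∈ F :=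
    Quotient.eq.trans QuotientGroup.rightRel_apply
  have hclass : ((hT.equiv g).1 : Z ⧸ F.subgroupOf Z) = (hT.equiv g').1 ↔
      ((hT.equiv g').1 : G) * ((hT.equiv g).1 : G)⁻¹ ∈ F := by
    rw [QuotientGroup.eq, mul_comm, Subgroup.mem_subgroupOf]
    rfl
  have hdiv : (hT.equiv g).2 = (hT.equiv g').2 →
      ((hT.equiv g').1 : G) * ((hT.equiv g).1 : G)⁻¹ = g' * g⁻¹ := fun h => by
    rw [hT.equiv_fst_eq_mul_inv, hT.equiv_fst_eq_mul_inv, h]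
    group
  rw [hcoset, hclass]
  constructor
  · intro h
    have hrep : (hT.equiv g).2 = (hT.equiv g').2 :=
      hT.equiv_snd_eq_iff_rightCosetEquivalence.2 ((rightCoset_eq_iff Z).2 (hF h))
    exact ⟨hrep, hdiv hrep ▸ h⟩
  · rintro ⟨hrep, h⟩
    exact hdiv hrep ▸ h

/-- The position of the right coset `F g`, for `g = z t` with `z ∈ Z` and `t` in the right
transversal `T` of `Z`: the pair of `t` and the class of `z` in the abelian group `Z ⧸ F`. -/
noncomputable def cosetPosition : RightCosets F → T × Additive (Z ⧸ F.subgroupOf Z) :=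
  Quotient.lift (fun g => ((hT.equiv g).2, Additive.ofMul ↑(hT.equiv g).1)) fun g g' h =>
    have h' := (rightCoset_eq_iff_equiv hT hF g g').1 (Quotient.sound h)
    Prod.ext h'.1 (congrArg Additive.ofMul h'.2)

theorem cosetPosition_rightCoset (g : G) : cosetPosition hT hF (rightCoset F g) =
    ((hT.equiv g).2, Additive.ofMul ↑(hT.equiv g).1) := rfl

theorem cosetPosition_injective : Function.Injective (cosetPosition hT hF) := by
  rintro ⟨g⟩ ⟨g'⟩ h
  obtain ⟨hrep, hclass⟩ := Prod.mk.inj h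
  exact (rightCoset_eq_iff_equiv hT hF g g').2 ⟨hrep, hclass⟩

theorem cosetPosition_one_snd (hone : 1 ∈ T) :
    (cosetPosition hT hF (rightCoset F 1)).2 = 0 := by
  rw [cosetPosition_rightCoset, hT.equiv_one Z.one_mem hone]
  rfl

theorem cosetPosition_mul (g s : G) {t : T} {a : Additive (Z ⧸ F.subgroupOf Z)}
    (hg : cosetPosition hT hF (rightCoset F g) = (t, a)) :
    cosetPosition hT hF (rightCoset F (g * s)) =
      ((cosetPosition hT hF (rightCoset F (t * s))).1,
        a + (cosetPosition hT hF (rightCoset F (t * s))).2) := by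
  obtain ⟨rfl, rfl⟩ := Prod.mk.inj hg
  have hmul : g * s = ((hT.equiv g).1 : G) * ((hT.equiv g).2 * s) := by
    rw [← mul_assoc, hT.equiv_fst_mul_equiv_snd]
  simp only [cosetPosition_rightCoset]
  rw [hmul, hT.equiv_mul_left]
  rfl

theorem isSemilinearSet_cosetPosition [Finite T] [Finite S] (hone : 1 ∈ T) (t : T) :
    IsSemilinearSet {x | ∃ w : List S, (cosetPosition hT hF (rightCoset F (eval w))).1 = t ∧
      ((cosetPosition hT hF (rightCoset F (eval w))).2, wordWeight ω w) = x} := by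
  have heval : ∀ (w : List S) (s : S), eval (w ++ [s]) = eval w * s := fun w s => by simp [eval]
  refine isSemilinearSet_word_labels
    (state := fun w : List S => (cosetPosition hT hF (rightCoset F (eval w))).1)
    (label := fun w => ((cosetPosition hT hF (rightCoset F (eval w))).2, wordWeight ω w))
    (δ := fun (t : T) (s : S) => (cosetPosition hT hF (rightCoset F (t * s))).1)
    (l := fun (t : T) (s : S) => ((cosetPosition hT hF (rightCoset F (t * s))).2, ω s)) ?_ ?_ ?_ t
  · intro w s
    rw [heval, cosetPosition_mul hT hF _ _ rfl]
    rfl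
  · exact Prod.ext (cosetPosition_one_snd hT hF hone) rfl
  · intro w s
    rw [heval, cosetPosition_mul hT hF _ _ rfl]
    exact Prod.ext rfl (by simp [wordWeight])

end Position

end Cosets

end CosetGrowth

open scoped IsMulCommutative in
theorem theorem4p2_general {G : Type*} [Group G] (Z : Subgroup G) [Z.FiniteIndex]
    [IsMulCommutative Z] (S : Set G) (hfin : S.Finite) (hS : Submonoid.closure S = ⊤)
    (ω : S → ℕ) (hω : ∀ s, 0 < ω s) (F : Subgroup G) (hF : F ≤ Z) :
    CosetGrowth.IsRational (CosetGrowth.cosetGrowthSeries F ω) := by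
  obtain ⟨T, hT, hone⟩ := Z.exists_isComplement_right 1
  have : Finite T := hT.finite_right
  have : Finite S := hfin
  exact CosetGrowth.isRational_cosetGrowthSeries_of_isSemilinearSet hfin hS hω
    (CosetGrowth.cosetPosition_injective hT hF)
    (CosetGrowth.isSemilinearSet_cosetPosition hT hF hone)

/-- `Z` is the normal finite-index subgroup of `G`, free abelian of rank `n`; the finite set `S`
generates `G` as a monoid and `ω` assigns a positive integer weight to each of its elements. -/
theorem theorem4p2 {G : Type*} [Group G] (n : ℕ) (Z : Subgroup G) [Z.Normal] [Z.FiniteIndex]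
    (e : Z ≃* Multiplicative (Fin n → ℤ))
    (S : Set G) (hfin : S.Finite) (hS : Submonoid.closure S = ⊤)
    (ω : S → ℕ) (hω : ∀ s, 0 < ω s)
    (F : Subgroup G) (hF : F ≤ Z) :
    CosetGrowth.IsRational (CosetGrowth.cosetGrowthSeries F ω) := by
  have : IsMulCommutative Z := .of_comm fun x y => e.injective (by simp [mul_comm])
  exact theorem4p2_general Z S hfin hS ω hω F hF
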